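/- **Perturbation bound for the best $R$-separable approximation.** Let $\mathcal H_1,\mathcal H_2$ be real Hilbert spaces, $\mathcal H_1\otimes\mathcal H_2$ their Hilbert space tensor product, and $\mathcal S_2(\cdot)$ the space of Hilbert–Schmidt operators with norm $\|\cdot\|_2$ and inner product $\langle S,T\rangle=\sum_j\langle Se_j,Te_j\rangle$ ($(e_j)$ any orthonormal basis). For $A\in\mathcal S_2(\mathcal H_1)$, $B\in\mathcal S_2(\mathcal H_2)$ let $A\,\tilde\otimes\,B\in\mathcal S_2(\mathcal H_1\otimes\mathcal H_2)$ be the operator with $(A\,\tilde\otimes\,B)(x\otimes y)=Ax\otimes By$. A separable component decomposition (SCD) of $C\in\mathcal S_2(\mathcal H_1\otimes\mathcal H_2)$ is an expansion $C=\sum_{r\ge1}\sigma_rA_r\,\tilde\otimes\,B_r$, convergent in $\|\cdot\|_2$, with scores $\sigma_1\ge\sigma_2\ge\dots\ge0$, $A_r\in\mathcal S_2(\mathcal H_1)$, $B_r\in\mathcal S_2(\mathcal H_2)$, where the $A_r$ with $\sigma_r>0$ are orthonormal in $\mathcal S_2(\mathcal H_1)$ and the $B_r$ with $\sigma_r>0$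 are orthonormal in $\mathcal S_2(\mathcal H_2)$. Its best $R$-separable approximation is $C_R:=\sum_{r=1}^R\sigma_rA_r\,\tilde\otimes\,B_r$. Let $C,\widetilde C\in\mathcal S_2(\mathcal H_1\otimes\mathcal H_2)$ have SCDs $C=\sum_r\sigma_rA_r\,\tilde\otimes\,B_r$ and $\widetilde C=\sum_r\tilde\sigma_r\widetilde A_r\,\tilde\otimes\,\widetilde B_r$, and let $C_R,\widetilde C_R$ be the corresponding best $R$-separable approximations, where $R\ge 0$ is an integer. Put $\alpha_1=\sigma_1^2-\sigma_2^2$ and $\alpha_r=\min\{\sigma_{r-1}^2-\sigma_r^2,\ \sigma_r^2-\sigma_{r+1}^2\}$ for $r\ge2$. Suppose that $\sigma_r>\sigma_{r+1}$ for every $r\le R$ with $\sigma_r>0$. Then $$ \|C_R-\widetilde C_R\|_2\ \le\ \Big\{4\sqrt2\,\big(\|C\|_2+\|\widetilde C\|_2\big)\sum_{r=1}^R\frac{\sigma_r}{\alpha_r}+1\Big\}\,\|C-\widetilde C\|_2, $$ where a term $\sigma_r/\alpha_r$ with $\sigma_r=0$ is read as $0$. -/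

import Mathlib

open scoped TensorProduct

namespace PSCA

noncomputable section

set_option linter.unusedSectionVars false

/-! ### Hilbert-Schmidt operators -/

section HilbertSchmidt

variable {H : Type*} [NormedAddCommGroup H] [InnerProductSpace ℝ H] [CompleteSpace H]

variable (H) in
/-- The index set of a fixed orthonormal basis (complete orthonormal system) of `H`. -/
def onbIndex : Set H := Classical.choose (exists_hilbertBasis ℝ H)

variable (H) in
/-- A fixed orthonormal basis (complete orthonormal system) of `H`. -/
def onb : HilbertBasis (onbIndex H) ℝ H :=
  Classical.choose (Classical.choose_spec (exists_hilbertBasis ℝ H))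

/-- `∑ ‖T e‖²` over an orthonormal basis, in `[0, ∞]`. -/
def energy {ι : Type*} (b : HilbertBasis ι ℝ H) (T : H →L[ℝ] H) : ENNReal :=
  ∑' i, ENNReal.ofReal (‖T (b i)‖ ^ 2)

theorem parseval {ι : Type*} (b : HilbertBasis ι ℝ H) (x : H) :
    ENNReal.ofReal (‖x‖ ^ 2) = ∑' i, ENNReal.ofReal (inner ℝ x (b i) ^ 2) := by
  have h := b.hasSum_inner_mul_inner x x
  have h2 : (fun i => inner ℝ x (b i) * inner ℝ (b i) x) = fun i => inner ℝ x (b i) ^ 2 := by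
    funext i; rw [real_inner_comm x (b i), sq]
  rw [h2, real_inner_self_eq_norm_sq] at h
  rw [← h.tsum_eq, ENNReal.ofReal_tsum_of_nonneg (fun i => sq_nonneg _) h.summable]

theorem energy_eq_adjoint {ι κ : Type*} (b : HilbertBasis ι ℝ H) (c : HilbertBasis κ ℝ H)
    (T : H →L[ℝ] H) : energy b T = energy c (ContinuousLinearMap.adjoint T) := by
  unfold energy
  simp_rw [parseval c (T _), parseval b (ContinuousLinearMap.adjoint T _)]
  rw [ENNReal.tsum_comm]
  refine tsum_congr fun k => tsum_congr fun i => ?_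
  rw [ContinuousLinearMap.adjoint_inner_left, real_inner_comm]

/-- The value of `∑ ‖T e‖²` does not depend on the orthonormal basis. -/
theorem energy_indep {ι κ : Type*} (b : HilbertBasis ι ℝ H) (c : HilbertBasis κ ℝ H)
    (T : H →L[ℝ] H) : energy b T = energy c T := by
  rw [energy_eq_adjoint b c, ← energy_eq_adjoint c c]

/-- A bounded operator `T` on `H` is Hilbert-Schmidt if `∑ ‖T e‖² < ∞` over an orthonormal
basis. -/
def IsHilbertSchmidt (T : H →L[ℝ] H) : Prop :=
  Summable fun i => ‖T (onb H i)‖ ^ 2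

theorem isHilbertSchmidt_iff_energy {ι : Type*} (b : HilbertBasis ι ℝ H) (T : H →L[ℝ] H) :
    IsHilbertSchmidt T ↔ energy b T ≠ ⊤ := by
  rw [energy_indep b (onb H)]
  exact ⟨fun h => h.tsum_ofReal_ne_top, fun h => by
    have := ENNReal.summable_toReal h
    simpa [IsHilbertSchmidt, ENNReal.toReal_ofReal] using this⟩

theorem IsHilbertSchmidt.summable_inner {S T : H →L[ℝ] H} (hS : IsHilbertSchmidt S)
    (hT : IsHilbertSchmidt T) :
    Summable fun i => inner ℝ (S (onb H i)) (T (onb H i)) := by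
  refine Summable.of_norm_bounded (Summable.add hS hT) fun i => ?_
  have h1 := abs_real_inner_le_norm (S (onb H i)) (T (onb H i))
  rw [Real.norm_eq_abs]
  nlinarith [sq_nonneg (‖S (onb H i)‖ - ‖T (onb H i)‖), sq_nonneg (‖S (onb H i)‖),
    sq_nonneg (‖T (onb H i)‖)]

variable (H) in
/-- The Hilbert-Schmidt operators, as a subspace of the bounded operators. -/
def hsSubmodule : Submodule ℝ (H →L[ℝ] H) where
  carrier := {T | IsHilbertSchmidt T}
  add_mem' := by
    intro S T hS hT
    refine Summable.of_nonneg_of_le (fun i => by positivity) (fun i => ?_)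
      ((Summable.add hS hT).mul_left 2)
    have h1 := norm_add_le (S (onb H i)) (T (onb H i))
    have h2 := norm_nonneg (S (onb H i) + T (onb H i))
    simp only [add_apply]
    nlinarith [sq_nonneg (‖S (onb H i)‖ - ‖T (onb H i)‖)]
  zero_mem' := by
    simp [IsHilbertSchmidt, summable_zero]
  smul_mem' := by
    intro c T hT
    have h : Summable fun i => ‖c‖ ^ 2 * ‖T (onb H i)‖ ^ 2 := Summable.mul_left _ hT
    simpa [IsHilbertSchmidt, norm_smul, mul_pow] using h

variable (H) in
/-- The space `S₂(H)` of Hilbert-Schmidt operators on `H`. It is a type of its own, because it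
carries the Hilbert-Schmidt inner product and norm and not the operator norm. -/
def HS : Type _ := hsSubmodule H

instance : AddCommGroup (HS H) := inferInstanceAs (AddCommGroup (hsSubmodule H))

instance : Module ℝ (HS H) := inferInstanceAs (Module ℝ (hsSubmodule H))

/-- The operator underlying an element of `S₂(H)`. -/
def HS.toOp (T : HS H) : H →L[ℝ] H := Subtype.val (p := (· ∈ hsSubmodule H)) T

/-- A bounded operator that is Hilbert-Schmidt, as an element of `S₂(H)`. -/
def HS.mk (T : H →L[ℝ] H) (hT : IsHilbertSchmidt T) : HS H :=
  Subtype.mk (p := (· ∈ hsSubmodule H)) T hT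

theorem HS.isHilbertSchmidt (T : HS H) : IsHilbertSchmidt T.toOp :=
  Subtype.prop (p := (· ∈ hsSubmodule H)) T

@[simp] theorem HS.toOp_mk (T : H →L[ℝ] H) (hT : IsHilbertSchmidt T) : (HS.mk T hT).toOp = T := rfl

@[simp] theorem HS.toOp_add (S T : HS H) : (S + T).toOp = S.toOp + T.toOp := rfl

@[simp] theorem HS.toOp_smul (c : ℝ) (T : HS H) : (c • T).toOp = c • T.toOp := rfl

@[ext] theorem HS.ext {S T : HS H} (h : S.toOp = T.toOp) : S = T := Subtype.ext h

/-- The inner product `⟪S, T⟫ = ∑ ⟪S e, T e⟫` on `S₂(H)`. -/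
@[reducible] def hsCore : InnerProductSpace.Core ℝ (HS H) where
  inner S T := ∑' i, inner ℝ (S.toOp (onb H i)) (T.toOp (onb H i))
  conj_inner_symm S T := by
    simp only [conj_trivial]
    exact tsum_congr fun i => real_inner_comm _ _
  re_inner_nonneg T := by
    simp only [RCLike.re_to_real]
    exact tsum_nonneg fun i => real_inner_self_nonneg
  add_left S T U := by
    simp only [HS.toOp_add, add_apply, inner_add_left]
    exact (S.isHilbertSchmidt.summable_inner U.isHilbertSchmidt).tsum_add
      (T.isHilbertSchmidt.summable_inner U.isHilbertSchmidt)
  smul_left S T c := by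
    simp only [HS.toOp_smul, smul_apply, real_inner_smul_left, conj_trivial]
    exact tsum_mul_left
  definite T hT := by
    have h1 : HasSum (fun i => inner ℝ (T.toOp (onb H i)) (T.toOp (onb H i))) 0 := by
      have h := (T.isHilbertSchmidt.summable_inner T.isHilbertSchmidt).hasSum
      have h0 : ∑' i, inner ℝ (T.toOp (onb H i)) (T.toOp (onb H i)) = 0 := hT
      rwa [h0] at h
    have h2 := (hasSum_zero_iff_of_nonneg (fun i => real_inner_self_nonneg)).1 h1
    refine HS.ext (ContinuousLinearMap.ext_on
      (Submodule.dense_iff_topologicalClosure_eq_top.2 (onb H).dense_span) ?_)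
    rintro _ ⟨i, rfl⟩
    exact inner_self_eq_zero.1 (congrFun h2 i)

instance : NormedAddCommGroup (HS H) :=
  InnerProductSpace.Core.toNormedAddCommGroup (𝕜 := ℝ) (cd := hsCore)

instance : InnerProductSpace ℝ (HS H) := InnerProductSpace.ofCore hsCore.toCore

end HilbertSchmidt

/-! ### The tensor product of Hilbert spaces and of operators -/

section Tensor

variable {H₁ H₂ : Type*} [NormedAddCommGroup H₁] [InnerProductSpace ℝ H₁] [CompleteSpace H₁]
  [NormedAddCommGroup H₂] [InnerProductSpace ℝ H₂] [CompleteSpace H₂]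

variable (H₁ H₂) in
/-- The Hilbert space tensor product: the completion of the algebraic tensor product under
`⟪x₁ ⊗ y₁, x₂ ⊗ y₂⟫ = ⟪x₁, x₂⟫ ⟪y₁, y₂⟫`. -/
abbrev HTensor : Type _ := UniformSpace.Completion (H₁ ⊗[ℝ] H₂)

/-- The pure tensor `x ⊗ y` in the Hilbert space tensor product. -/
def htmul (x : H₁) (y : H₂) : HTensor H₁ H₂ := ((x ⊗ₜ[ℝ] y : H₁ ⊗[ℝ] H₂) : HTensor H₁ H₂)

theorem inner_htmul (x x' : H₁) (y y' : H₂) :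
    inner ℝ (htmul x y) (htmul x' y') = inner ℝ x x' * inner ℝ y y' := by
  simp [htmul]

/-- The bounded operator on the Hilbert space tensor product with `x ⊗ y ↦ A x ⊗ B y`. -/
def opTensor (A : H₁ →L[ℝ] H₁) (B : H₂ →L[ℝ] H₂) : HTensor H₁ H₂ →L[ℝ] HTensor H₁ H₂ :=
  (TensorProduct.mapL A B).completion

theorem opTensor_htmul (A : H₁ →L[ℝ] H₁) (B : H₂ →L[ℝ] H₂) (x : H₁) (y : H₂) :
    opTensor A B (htmul x y) = htmul (A x) (B y) := by
  simp [opTensor, htmul]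

theorem orthonormal_htmul {ι κ : Type*} {b : ι → H₁} {c : κ → H₂} (hb : Orthonormal ℝ b)
    (hc : Orthonormal ℝ c) : Orthonormal ℝ fun p : ι × κ => htmul (b p.1) (c p.2) := by
  classical
  rw [orthonormal_iff_ite] at *
  rintro ⟨i, k⟩ ⟨j, l⟩
  rw [inner_htmul, hb, hc]
  by_cases h1 : i = j <;> by_cases h2 : k = l <;> simp [h1, h2]

theorem htmul_orthogonal_eq_bot {ι κ : Type*} (b : HilbertBasis ι ℝ H₁)
    (c : HilbertBasis κ ℝ H₂) :
    (Submodule.span ℝ (Set.range fun p : ι × κ => htmul (b p.1) (c p.2)))ᗮ = ⊥ := by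
  rw [eq_bot_iff]
  intro z hz
  have h0 : ∀ i k, inner ℝ z (htmul (b i) (c k)) = 0 := fun i k => by
    rw [real_inner_comm]
    exact hz _ (Submodule.subset_span ⟨(i, k), rfl⟩)
  have cont1 : ∀ y : H₂, Continuous fun x : H₁ => inner ℝ z (htmul x y) := fun y => by
    have := (TensorProduct.mkL ℝ H₁ H₂).flip y |>.continuous
    exact continuous_const.inner ((UniformSpace.Completion.continuous_coe _).comp this)
  have cont2 : ∀ x : H₁, Continuous fun y : H₂ => inner ℝ z (htmul x y) := fun x => by
    have := (TensorProduct.mkL ℝ H₁ H₂) x |>.continuous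
    exact continuous_const.inner ((UniformSpace.Completion.continuous_coe _).comp this)
  have h1 : ∀ x k, inner ℝ z (htmul x (c k)) = 0 := by
    intro x k
    let f : H₁ →L[ℝ] ℝ :=
      { toFun := fun x => inner ℝ z (htmul x (c k))
        map_add' := fun x y => by
          rw [htmul, TensorProduct.add_tmul, UniformSpace.Completion.coe_add, inner_add_right]
          rfl
        map_smul' := fun r x => by
          simp [htmul, ← TensorProduct.smul_tmul', inner_smul_right]
        cont := cont1 _ }
    have hf : f = 0 := by
      refine ContinuousLinearMap.ext_on
        (Submodule.dense_iff_topologicalClosure_eq_top.2 b.dense_span) ?_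
      rintro _ ⟨i, rfl⟩
      exact h0 i k
    exact congrArg (fun g : H₁ →L[ℝ] ℝ => g x) hf
  have h2 : ∀ x y, inner ℝ z (htmul x y) = 0 := by
    intro x y
    let f : H₂ →L[ℝ] ℝ :=
      { toFun := fun y => inner ℝ z (htmul x y)
        map_add' := fun u v => by
          rw [htmul, TensorProduct.tmul_add, UniformSpace.Completion.coe_add, inner_add_right]
          rfl
        map_smul' := fun r v => by
          simp [htmul, TensorProduct.tmul_smul, inner_smul_right]
        cont := cont2 _ }
    have hf : f = 0 := by
      refine ContinuousLinearMap.ext_on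
        (Submodule.dense_iff_topologicalClosure_eq_top.2 c.dense_span) ?_
      rintro _ ⟨k, rfl⟩
      exact h1 x k
    exact congrArg (fun g : H₂ →L[ℝ] ℝ => g y) hf
  have h3 : ∀ w : HTensor H₁ H₂, inner ℝ z w = 0 := by
    intro w
    induction w using UniformSpace.Completion.induction_on with
    | hp => exact isClosed_eq (continuous_const.inner continuous_id) continuous_const
    | ih t =>
      induction t using TensorProduct.induction_on with
      | zero => rw [UniformSpace.Completion.coe_zero, inner_zero_right]
      | tmul x y => exact h2 x y
      | add s t hs ht => rw [UniformSpace.Completion.coe_add, inner_add_right, hs, ht, add_zero]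
  exact (Submodule.mem_bot ℝ).2 (inner_self_eq_zero.1 (h3 z))

/-- The products of the elements of two orthonormal bases form an orthonormal basis. -/
def htensorBasis {ι κ : Type*} (b : HilbertBasis ι ℝ H₁) (c : HilbertBasis κ ℝ H₂) :
    HilbertBasis (ι × κ) ℝ (HTensor H₁ H₂) :=
  HilbertBasis.mkOfOrthogonalEqBot (orthonormal_htmul b.orthonormal c.orthonormal)
    (htmul_orthogonal_eq_bot b c)

theorem norm_htmul (x : H₁) (y : H₂) : ‖htmul x y‖ = ‖x‖ * ‖y‖ := by
  simp [htmul]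

theorem isHilbertSchmidt_opTensor {A : H₁ →L[ℝ] H₁} {B : H₂ →L[ℝ] H₂} (hA : IsHilbertSchmidt A)
    (hB : IsHilbertSchmidt B) : IsHilbertSchmidt (opTensor A B) := by
  rw [isHilbertSchmidt_iff_energy (onb H₁)] at hA
  rw [isHilbertSchmidt_iff_energy (onb H₂)] at hB
  rw [isHilbertSchmidt_iff_energy (htensorBasis (onb H₁) (onb H₂))]
  have h : energy (htensorBasis (onb H₁) (onb H₂)) (opTensor A B)
      = energy (onb H₁) A * energy (onb H₂) B := by
    unfold energy
    simp only [htensorBasis, HilbertBasis.coe_mkOfOrthogonalEqBot, opTensor_htmul, norm_htmul,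
      mul_pow]
    rw [ENNReal.tsum_prod', ← ENNReal.tsum_mul_right]
    refine tsum_congr fun i => ?_
    rw [← ENNReal.tsum_mul_left]
    refine tsum_congr fun k => ?_
    exact ENNReal.ofReal_mul (sq_nonneg _)
  rw [h]
  exact ENNReal.mul_ne_top hA hB

/-- The Hilbert-Schmidt operator on `H₁ ⊗ H₂` determined by `x ⊗ y ↦ A x ⊗ B y`, for `A`, `B`
Hilbert-Schmidt. -/
def HS.tensor (A : HS H₁) (B : HS H₂) : HS (HTensor H₁ H₂) :=
  HS.mk (opTensor A.toOp B.toOp) (isHilbertSchmidt_opTensor A.isHilbertSchmidt B.isHilbertSchmidt)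

/-! ### The separable component decomposition -/

/-- `C = ∑ σ_r A_r ⊗ B_r` is a separable component decomposition (SCD) of `C`: the scores `σ` are
nonincreasing and nonnegative and the `A_r`, respectively the `B_r`, are orthonormal for the
Hilbert-Schmidt inner product. Indices start from `0`. Components with score zero do not matter and
are not restricted, so that operators with finitely many nonzero scores, finite-dimensional spaces,
and systems that do not extend to bases indexed by `ℕ` are included; an SCD with full orthonormal
bases `(A_r)`, `(B_r)` is a special case. -/
structure IsSCD (C : HS (HTensor H₁ H₂)) (σ : ℕ → ℝ) (A : ℕ → HS H₁) (B : ℕ → HS H₂) : Prop where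
  nonneg : ∀ r, 0 ≤ σ r
  antitone : Antitone σ
  orthonormal_left : Orthonormal ℝ fun r : {r : ℕ // σ r ≠ 0} => A r
  orthonormal_right : Orthonormal ℝ fun r : {r : ℕ // σ r ≠ 0} => B r
  hasSum : HasSum (fun r => σ r • HS.tensor (A r) (B r)) C

/-- The best `R`-separable approximation given by an SCD: its truncation to the `R` leading
components. -/
def bestSeparable (σ : ℕ → ℝ) (A : ℕ → HS H₁) (B : ℕ → HS H₂) (R : ℕ) : HS (HTensor H₁ H₂) :=
  ∑ r ∈ Finset.range R, σ r • HS.tensor (A r) (B r)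

end Tensor

/-- The spectral gap `min {σ_{r-1}² - σ_r², σ_r² - σ_{r+1}²}` of the squared scores, where the
leading score has only a lower neighbour. -/
def scoreGap (σ : ℕ → ℝ) : ℕ → ℝ
  | 0 => σ 0 ^ 2 - σ 1 ^ 2
  | r + 1 => min (σ r ^ 2 - σ (r + 1) ^ 2) (σ (r + 1) ^ 2 - σ (r + 2) ^ 2)

end

end PSCA

namespace PSCA

/-! ### Hilbert-Schmidt inner products in an arbitrary orthonormal basis -/

section Basis

variable {H : Type*} [NormedAddCommGroup H] [InnerProductSpace ℝ H] [CompleteSpace H]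

/-! Elementary tensors satisfy `⟪A ⊗ B, A' ⊗ B'⟫ = ⟪A, A'⟫⟪B, B'⟫`, so an SCD behaves like a
singular value decomposition and its truncations are best approximations of bounded rank
(`eckart_young`). No perturbation theory for the individual components is needed: the truncations
are compared as minimizers.

Write `T = C_R`, `X = C'_R`, `R = m + 1`. Inflating the tail of the SCD by `σ_m / σ_{m+1}` keeps the
scores ordered, so `T` stays optimal for the inflated operator. This gives quadratic growth
(`truncation_quadratic_growth`): `(σ_m - σ_{m+1}) ‖X - T‖² ≤ σ_m (‖C - X‖² - ‖C - T‖²)`. Since `X`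
is optimal for `C'`, the last bracket is at most `2⟪C - C', T - X⟫`, and Cauchy-Schwarz yields `(σ_m
- σ_{m+1}) ‖T - X‖ ≤ 2 σ_m ‖C - C'‖` (`IsSCD.gap_mul_norm_sub_le`).

This is stronger than the claim. The sum dominates its last term, and `σ_m² - σ_{m+1}² ≤ 2 σ_m (σ_m
- σ_{m+1})` together with `σ_m ≤ ‖C‖` makes that term large enough (`IsSCD.two_mul_score_le`). If
`σ_m = 0`, then `C_R = C` and the triangle inequality suffices. -/

theorem HS.inner_def (S T : HS H) :
    inner ℝ S T = ∑' i, inner ℝ (S.toOp (onb H i)) (T.toOp (onb H i)) := rfl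

theorem HS.summable_norm_sq {ι : Type*} (b : HilbertBasis ι ℝ H) (T : HS H) :
    Summable fun i => ‖T.toOp (b i)‖ ^ 2 := by
  have h := ENNReal.summable_toReal ((isHilbertSchmidt_iff_energy b _).1 T.isHilbertSchmidt)
  simpa [ENNReal.toReal_ofReal] using h

theorem HS.tsum_norm_sq {ι : Type*} (b : HilbertBasis ι ℝ H) (T : HS H) :
    ∑' i, ‖T.toOp (b i)‖ ^ 2 = (energy b T.toOp).toReal := by
  rw [energy, ← ENNReal.ofReal_tsum_of_nonneg (fun i => sq_nonneg _) (T.summable_norm_sq b),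
    ENNReal.toReal_ofReal (tsum_nonneg fun i => sq_nonneg _)]

theorem HS.hasSum_norm_sq {ι : Type*} (b : HilbertBasis ι ℝ H) (T : HS H) :
    HasSum (fun i => ‖T.toOp (b i)‖ ^ 2) (‖T‖ ^ 2) := by
  have h : ‖T‖ ^ 2 = ∑' i, ‖T.toOp (b i)‖ ^ 2 := by
    rw [HS.tsum_norm_sq, energy_indep b (onb H), ← HS.tsum_norm_sq,
      ← real_inner_self_eq_norm_sq, HS.inner_def]
    simp only [real_inner_self_eq_norm_sq]
  rw [h]
  exact (T.summable_norm_sq b).hasSum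

/-- Polarization of the norm formula. Freedom of basis lets inner products on `H₁ ⊗ H₂` be computed
in the product basis. -/
theorem HS.hasSum_inner {ι : Type*} (b : HilbertBasis ι ℝ H) (S T : HS H) :
    HasSum (fun i => inner ℝ (S.toOp (b i)) (T.toOp (b i))) (inner ℝ S T) := by
  have h := (((S + T).hasSum_norm_sq b).sub (S.hasSum_norm_sq b)).sub (T.hasSum_norm_sq b)
  have h1 : ∀ x y : H, (‖x + y‖ ^ 2 - ‖x‖ ^ 2 - ‖y‖ ^ 2) / 2 = inner ℝ x y := fun x y => by
    rw [norm_add_sq_real]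
    ring
  have h2 : (‖S + T‖ ^ 2 - ‖S‖ ^ 2 - ‖T‖ ^ 2) / 2 = inner ℝ S T := by
    rw [norm_add_sq_real]
    ring
  have h3 := h.div_const 2
  simp only [HS.toOp_add, add_apply, h1] at h3
  rwa [h2] at h3

end Basis

/-! ### Inner products and bilinearity of elementary tensors -/

section Tensor

variable {H₁ H₂ : Type*} [NormedAddCommGroup H₁] [InnerProductSpace ℝ H₁] [CompleteSpace H₁]
  [NormedAddCommGroup H₂] [InnerProductSpace ℝ H₂] [CompleteSpace H₂]

theorem hasSum_mul_of_hasSum {ι κ : Type*} {f : ι → ℝ} {g : κ → ℝ} {x y : ℝ} (hf : HasSum f x)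
    (hg : HasSum g y) : HasSum (fun p : ι × κ => f p.1 * g p.2) (x * y) :=
  hf.mul hg (summable_mul_of_summable_norm hf.summable.norm hg.summable.norm)

theorem HS.inner_tensor (A A' : HS H₁) (B B' : HS H₂) :
    inner ℝ (HS.tensor A B) (HS.tensor A' B') = inner ℝ A A' * inner ℝ B B' := by
  have h := HS.hasSum_inner (htensorBasis (onb H₁) (onb H₂)) (HS.tensor A B) (HS.tensor A' B')
  have hA := HS.hasSum_inner (onb H₁) A A'
  have hB := HS.hasSum_inner (onb H₂) B B'
  have hAB := hasSum_mul_of_hasSum hA hB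
  simp only [HS.tensor, HS.toOp_mk, htensorBasis, HilbertBasis.coe_mkOfOrthogonalEqBot,
    opTensor_htmul, inner_htmul] at h
  exact h.unique hAB

/-- `HS.tensor` as a bilinear map. -/
noncomputable def HS.tensorₗ : HS H₁ →ₗ[ℝ] HS H₂ →ₗ[ℝ] HS (HTensor H₁ H₂) :=
  LinearMap.mk₂ ℝ HS.tensor
    (fun A A' B => by
      -- The difference of the two sides has norm zero, because `HS.inner_tensor` determines all
      -- inner products involved.
      rw [← sub_eq_zero, ← inner_self_eq_zero (𝕜 := ℝ)]
      simp only [inner_sub_left, inner_sub_right, inner_add_left, inner_add_right, HS.inner_tensor]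
      ring)
    (fun c A B => by
      rw [← sub_eq_zero, ← inner_self_eq_zero (𝕜 := ℝ)]
      simp only [inner_sub_left, inner_sub_right, real_inner_smul_left, real_inner_smul_right,
        HS.inner_tensor]
      ring)
    (fun A B B' => by
      rw [← sub_eq_zero, ← inner_self_eq_zero (𝕜 := ℝ)]
      simp only [inner_sub_left, inner_sub_right, inner_add_left, inner_add_right, HS.inner_tensor]
      ring)
    (fun c A B => by
      rw [← sub_eq_zero, ← inner_self_eq_zero (𝕜 := ℝ)]
      simp only [inner_sub_left, inner_sub_right, real_inner_smul_left, real_inner_smul_right,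
        HS.inner_tensor]
      ring)

@[simp] theorem HS.tensorₗ_apply (A : HS H₁) (B : HS H₂) :
    HS.tensorₗ A B = HS.tensor A B := rfl

end Tensor

/-! ### Low-rank approximation for finite sums of tensors -/

section LowRank

variable {V W E : Type*} [NormedAddCommGroup V] [InnerProductSpace ℝ V]
  [NormedAddCommGroup W] [InnerProductSpace ℝ W] [NormedAddCommGroup E] [InnerProductSpace ℝ E]

/-- An antitone weight integrates a density bounded by `1` of total mass at most `R` to at most
the sum of its first `R` values. -/
theorem sum_mul_le_sum_range_of_antitone {w p : ℕ → ℝ} (hw : Antitone w) (hw0 : ∀ r, 0 ≤ w r)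
    (hp0 : ∀ r, 0 ≤ p r) (hp1 : ∀ r, p r ≤ 1) {R n : ℕ} (hRn : R ≤ n)
    (hp : ∑ r ∈ Finset.range n, p r ≤ R) :
    ∑ r ∈ Finset.range n, w r * p r ≤ ∑ r ∈ Finset.range R, w r := by
  rw [← Finset.sum_range_add_sum_Ico _ hRn] at hp ⊢
  -- The weight `w R` separates head from tail: tail mass earns at most `w R` per unit, mass missing
  -- from the head costs at least `w R` per unit, and the tail mass does not exceed the missing
  -- mass.
  have h1 : ∑ r ∈ Finset.Ico R n, w r * p r ≤ w R * ∑ r ∈ Finset.Ico R n, p r := by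
    rw [Finset.mul_sum]
    exact Finset.sum_le_sum fun r hr =>
      mul_le_mul_of_nonneg_right (hw (Finset.mem_Ico.1 hr).1) (hp0 r)
  have h2 : w R * ∑ r ∈ Finset.range R, (1 - p r)
      ≤ ∑ r ∈ Finset.range R, w r * (1 - p r) := by
    rw [Finset.mul_sum]
    exact Finset.sum_le_sum fun r hr =>
      mul_le_mul_of_nonneg_right (hw (Finset.mem_range.1 hr).le) (sub_nonneg.2 (hp1 r))
  simp only [mul_sub, mul_one, Finset.sum_sub_distrib, Finset.sum_const, Finset.card_range,
    nsmul_eq_mul] at h2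
  have h3 := mul_le_mul_of_nonneg_left hp (hw0 R)
  linarith

/-- The finite sum `∑_{r < n} σ_r a_r ⊗ b_r`, for a bilinear map `t` in the place of `⊗`. -/
def partialSum (t : V →ₗ[ℝ] W →ₗ[ℝ] E) (σ : ℕ → ℝ) (a : ℕ → V) (b : ℕ → W) (n : ℕ) : E :=
  ∑ r ∈ Finset.range n, σ r • t (a r) (b r)

variable {t : V →ₗ[ℝ] W →ₗ[ℝ] E}

/-- The squared norm of `∑ σ_r x_r ⊗ b_r`, where the `b_r` with `σ_r ≠ 0` are orthonormal. -/
theorem norm_sq_sum_tensor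
    (ht : ∀ x x' y y', inner ℝ (t x y) (t x' y') = inner ℝ x x' * inner ℝ y y')
    {σ : ℕ → ℝ} {b : ℕ → W} (hb : Orthonormal ℝ fun r : {r : ℕ // σ r ≠ 0} => b r)
    (x : ℕ → V) (s : Finset ℕ) :
    ‖∑ r ∈ s, σ r • t (x r) (b r)‖ ^ 2 = ∑ r ∈ s, σ r ^ 2 * ‖x r‖ ^ 2 := by
  classical
  rw [← real_inner_self_eq_norm_sq, sum_inner]
  refine Finset.sum_congr rfl fun r hr => ?_
  rw [inner_sum, Finset.sum_eq_single_of_mem r hr]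
  · rw [real_inner_smul_left, real_inner_smul_right, ht, real_inner_self_eq_norm_sq,
      real_inner_self_eq_norm_sq]
    by_cases h : σ r = 0
    · simp [h]
    · have : ‖b r‖ = 1 := hb.1 ⟨r, h⟩
      rw [this]
      ring
  · intro q _ hq
    rw [real_inner_smul_left, real_inner_smul_right, ht]
    by_cases h : σ r = 0
    · simp [h]
    by_cases h' : σ q = 0
    · simp [h']
    have : inner ℝ (b r) (b q) = 0 :=
      hb.2 (i := ⟨r, h⟩) (j := ⟨q, h'⟩) (fun e => hq (congrArg Subtype.val e).symm)
    rw [this]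
    ring

theorem norm_sq_sum_tensor_of_orthonormal
    (ht : ∀ x x' y y', inner ℝ (t x y) (t x' y') = inner ℝ x x' * inner ℝ y y')
    {σ : ℕ → ℝ} {a : ℕ → V} {b : ℕ → W} (ha : Orthonormal ℝ fun r : {r : ℕ // σ r ≠ 0} => a r)
    (hb : Orthonormal ℝ fun r : {r : ℕ // σ r ≠ 0} => b r) (s : Finset ℕ) :
    ‖∑ r ∈ s, σ r • t (a r) (b r)‖ ^ 2 = ∑ r ∈ s, σ r ^ 2 := by
  rw [norm_sq_sum_tensor ht hb]
  refine Finset.sum_congr rfl fun r _ => ?_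
  by_cases h : σ r = 0
  · simp [h]
  · have : ‖a r‖ = 1 := ha.1 ⟨r, h⟩
    rw [this]
    ring

/-- Eckart-Young: no tensor of rank at most `R` is closer to `∑_{r < n} σ_r a_r ⊗ b_r` than the
truncation to the `R` leading terms. -/
theorem eckart_young
    (ht : ∀ x x' y y', inner ℝ (t x y) (t x' y') = inner ℝ x x' * inner ℝ y y')
    {σ : ℕ → ℝ} (hσ0 : ∀ r, 0 ≤ σ r) (hσ : Antitone σ) {a : ℕ → V} {b : ℕ → W}
    (ha : Orthonormal ℝ fun r : {r : ℕ // σ r ≠ 0} => a r)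
    (hb : Orthonormal ℝ fun r : {r : ℕ // σ r ≠ 0} => b r)
    {κ : Type*} [Fintype κ] {u : κ → V} (hu : Orthonormal ℝ u) (y : κ → W) {R n : ℕ}
    (hκ : Fintype.card κ ≤ R) (hRn : R ≤ n) :
    ‖partialSum t σ a b n - partialSum t σ a b R‖ ^ 2
      ≤ ‖partialSum t σ a b n - ∑ j, t (u j) (y j)‖ ^ 2 := by
  classical
  -- The orthogonal projection onto the span of the `u j`.
  set P : V → V := fun x => ∑ j, inner ℝ (u j) x • u j with hP
  have hPu : ∀ x j, inner ℝ (x - P x) (u j) = 0 := by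
    intro x j
    rw [inner_sub_left, hP, hu.inner_left_fintype, conj_trivial, real_inner_comm, sub_self]
  have hPx : ∀ x, ‖x - P x‖ ^ 2 = ‖x‖ ^ 2 - ∑ j, inner ℝ (u j) x ^ 2 := by
    intro x
    have h0 : inner ℝ (x - P x) (P x) = 0 := by
      rw [hP, inner_sum]
      refine Finset.sum_eq_zero fun j _ => ?_
      rw [real_inner_smul_right, hPu, mul_zero]
    have h1 : inner ℝ x (P x) = ∑ j, inner ℝ (u j) x ^ 2 := by
      rw [hP, inner_sum]
      refine Finset.sum_congr rfl fun j _ => ?_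
      rw [real_inner_smul_right, real_inner_comm x, sq]
    rw [← real_inner_self_eq_norm_sq (x - P x), inner_sub_right, h0, sub_zero, inner_sub_left,
      real_inner_self_eq_norm_sq, real_inner_comm, h1]
  -- The first summand has left factors orthogonal to all `u j`, the second has left factors in
  -- their span. By Pythagoras the first alone bounds the distance from below, whatever `y` is.
  have hsplit : partialSum t σ a b n - ∑ j, t (u j) (y j)
      = (∑ r ∈ Finset.range n, σ r • t (a r - P (a r)) (b r))
        + (∑ r ∈ Finset.range n, σ r • t (P (a r)) (b r) - ∑ j, t (u j) (y j)) := by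
    rw [partialSum, ← add_sub_assoc, ← Finset.sum_add_distrib]
    congr 1
    refine Finset.sum_congr rfl fun r _ => ?_
    rw [← smul_add, ← LinearMap.add_apply, ← map_add, sub_add_cancel]
  have horth : inner ℝ (∑ r ∈ Finset.range n, σ r • t (a r - P (a r)) (b r))
      (∑ r ∈ Finset.range n, σ r • t (P (a r)) (b r) - ∑ j, t (u j) (y j)) = 0 := by
    rw [sum_inner]
    refine Finset.sum_eq_zero fun r _ => ?_
    rw [inner_sub_right, inner_sum, inner_sum, Finset.sum_eq_zero, Finset.sum_eq_zero, sub_zero]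
    · intro j _
      rw [real_inner_smul_left, ht, hPu, zero_mul, mul_zero]
    · intro q _
      have : inner ℝ (a r - P (a r)) (P (a q)) = 0 := by
        rw [hP, inner_sum]
        refine Finset.sum_eq_zero fun j _ => ?_
        rw [real_inner_smul_right, hPu, mul_zero]
      rw [real_inner_smul_left, real_inner_smul_right, ht, this, zero_mul, mul_zero, mul_zero]
  -- This is `‖P (a r)‖²`, except where the score vanishes: there `a r` is unconstrained and could
  -- break `p r ≤ 1` and the mass bound.
  set p : ℕ → ℝ := fun r => if σ r = 0 then 0 else ∑ j, inner ℝ (u j) (a r) ^ 2 with hp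
  have hp0 : ∀ r, 0 ≤ p r := by
    intro r
    rw [hp]
    dsimp only
    split_ifs
    exacts [le_rfl, Finset.sum_nonneg fun j _ => sq_nonneg _]
  have hp1 : ∀ r, p r ≤ 1 := by
    intro r
    rw [hp]
    dsimp only
    split_ifs with h
    · exact zero_le_one
    · have h1 : ‖a r‖ = 1 := ha.1 ⟨r, h⟩
      have h2 := hPx (a r)
      rw [h1] at h2
      nlinarith [sq_nonneg ‖a r - P (a r)‖]
  have hpR : ∑ r ∈ Finset.range n, p r ≤ R := by
    have h1 : ∑ r ∈ Finset.range n, p r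
        = ∑ j, ∑ r ∈ (Finset.range n).subtype (fun r => σ r ≠ 0), inner ℝ (u j) (a r) ^ 2 := by
      rw [Finset.sum_comm, Finset.sum_subtype_eq_sum_filter
        (f := fun r => ∑ j, inner ℝ (u j) (a r) ^ 2), Finset.sum_filter]
      refine Finset.sum_congr rfl fun r _ => ?_
      by_cases h : σ r = 0 <;> simp [hp, h]
    rw [h1]
    calc _ ≤ ∑ j : κ, (1 : ℝ) := by
          refine Finset.sum_le_sum fun j _ => ?_
          -- Bessel for the orthonormal `a r`, applied to each unit vector `u j`: every `j`
          -- contributes mass at most `1`.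
          have h2 := ha.sum_inner_products_le (u j)
            (s := (Finset.range n).subtype (fun r => σ r ≠ 0))
          rw [hu.1 j, one_pow] at h2
          refine le_trans (le_of_eq (Finset.sum_congr rfl fun r _ => ?_)) h2
          rw [Real.norm_eq_abs, sq_abs, real_inner_comm]
      _ ≤ R := by simpa using hκ
  have hN : ‖∑ r ∈ Finset.range n, σ r • t (a r - P (a r)) (b r)‖ ^ 2
      = ∑ r ∈ Finset.range n, σ r ^ 2 - ∑ r ∈ Finset.range n, σ r ^ 2 * p r := by
    rw [norm_sq_sum_tensor ht hb, ← Finset.sum_sub_distrib]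
    refine Finset.sum_congr rfl fun r _ => ?_
    by_cases h : σ r = 0
    · simp [h]
    · have h1 : ‖a r‖ = 1 := ha.1 ⟨r, h⟩
      rw [hPx, h1, hp]
      simp only [h, if_false]
      ring
  have hw := sum_mul_le_sum_range_of_antitone (w := fun r => σ r ^ 2)
    (fun i j hij => pow_le_pow_left₀ (hσ0 j) (hσ hij) 2) (fun r => sq_nonneg _) hp0 hp1 hRn hpR
  have hL : ‖partialSum t σ a b n - partialSum t σ a b R‖ ^ 2
      = ∑ r ∈ Finset.range n, σ r ^ 2 - ∑ r ∈ Finset.range R, σ r ^ 2 := by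
    rw [partialSum, partialSum, ← Finset.sum_Ico_eq_sub _ hRn, ← Finset.sum_Ico_eq_sub _ hRn,
      norm_sq_sum_tensor_of_orthonormal ht ha hb]
  rw [hL, hsplit, norm_add_sq_real, horth, hN]
  nlinarith [sq_nonneg ‖∑ r ∈ Finset.range n, σ r • t (P (a r)) (b r) - ∑ j, t (u j) (y j)‖]

theorem orthonormal_subtype_mono {P Q : ℕ → Prop} {d : ℕ → V}
    (hd : Orthonormal ℝ fun r : {r : ℕ // P r} => d r) (h : ∀ r, Q r → P r) :
    Orthonormal ℝ fun r : {r : ℕ // Q r} => d r :=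
  hd.comp (Subtype.map id h) (Subtype.map_injective h Function.injective_id)

/-- Quadratic growth of the squared distance around the truncation to the `m + 1` leading terms. -/
theorem truncation_quadratic_growth
    (ht : ∀ x x' y y', inner ℝ (t x y) (t x' y') = inner ℝ x x' * inner ℝ y y')
    {σ : ℕ → ℝ} (hσ0 : ∀ r, 0 ≤ σ r) (hσ : Antitone σ) {a : ℕ → V} {b : ℕ → W}
    (ha : Orthonormal ℝ fun r : {r : ℕ // σ r ≠ 0} => a r)
    (hb : Orthonormal ℝ fun r : {r : ℕ // σ r ≠ 0} => b r)
    {κ : Type*} [Fintype κ] {u : κ → V} (hu : Orthonormal ℝ u) (y : κ → W) {m n : ℕ}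
    (hκ : Fintype.card κ ≤ m + 1) (hn : m + 1 ≤ n) :
    (σ m - σ (m + 1)) * ‖∑ j, t (u j) (y j) - partialSum t σ a b (m + 1)‖ ^ 2
      ≤ σ m * (‖partialSum t σ a b n - ∑ j, t (u j) (y j)‖ ^ 2
        - ‖partialSum t σ a b n - partialSum t σ a b (m + 1)‖ ^ 2) := by
  set X := ∑ j, t (u j) (y j) with hX
  set T := partialSum t σ a b (m + 1) with hT
  set F := partialSum t σ a b n - T with hF
  have hFs : F = ∑ r ∈ Finset.Ico (m + 1) n, σ r • t (a r) (b r) := by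
    rw [hF, hT, partialSum, partialSum, Finset.sum_Ico_eq_sub _ hn]
  have hdiff : partialSum t σ a b n - X = F - (X - T) := by rw [hF]; abel
  -- If `σ (m + 1) = 0` the tail vanishes and both sides agree; otherwise the inflation factor below
  -- is defined.
  rcases (hσ0 (m + 1)).eq_or_lt with h0 | hpos
  · have hF0 : F = 0 := by
      rw [hFs]
      refine Finset.sum_eq_zero fun r hr => ?_
      have : σ r = 0 := le_antisymm (h0 ▸ hσ (Finset.mem_Ico.1 hr).1) (hσ0 r)
      rw [this, zero_smul]
    rw [hdiff, hF0, zero_sub, norm_neg, ← h0, norm_zero]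
    apply le_of_eq
    ring
  -- The largest factor by which the tail can be scaled without its top score exceeding `σ m`.
  set c : ℝ := σ m / σ (m + 1) with hc
  have hm : 0 < σ m := hpos.trans_le (hσ m.le_succ)
  have hc0 : 0 < c := div_pos hm hpos
  have hc1 : c * σ (m + 1) = σ m := div_mul_cancel₀ _ hpos.ne'
  set μ : ℕ → ℝ := fun r => if r ≤ m then σ r else c * σ r with hμ
  have hμne : ∀ r, μ r ≠ 0 ↔ σ r ≠ 0 := by
    intro r
    by_cases h : r ≤ m <;> simp [hμ, h, hc0.ne']
  have hμ0 : ∀ r, 0 ≤ μ r := by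
    intro r
    rw [hμ]
    dsimp only
    split_ifs
    exacts [hσ0 r, mul_nonneg hc0.le (hσ0 r)]
  have hμa : Antitone μ := by
    intro i j hij
    rw [hμ]
    dsimp only
    split_ifs with h1 h2 h3
    · exact hσ hij
    · exact absurd (hij.trans h1) h2
    · calc c * σ j ≤ c * σ (m + 1) :=
            mul_le_mul_of_nonneg_left (hσ (Nat.lt_of_not_le h1)) hc0.le
        _ = σ m := hc1
        _ ≤ σ i := hσ h3
    · exact mul_le_mul_of_nonneg_left (hσ hij) hc0.le
  have key := eckart_young ht hμ0 hμa (orthonormal_subtype_mono ha fun r => (hμne r).1)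
    (orthonormal_subtype_mono hb fun r => (hμne r).1) hu y hκ hn
  have hTμ : partialSum t μ a b (m + 1) = T := by
    rw [hT, partialSum, partialSum]
    refine Finset.sum_congr rfl fun r hr => ?_
    rw [hμ]
    simp only [Nat.le_of_lt_succ (Finset.mem_range.1 hr), if_true]
  have hFμ : partialSum t μ a b n - T = c • F := by
    rw [← hTμ, hFs, partialSum, partialSum, ← Finset.sum_Ico_eq_sub _ hn, Finset.smul_sum]
    refine Finset.sum_congr rfl fun r hr => ?_
    have : ¬ r ≤ m := by have := (Finset.mem_Ico.1 hr).1; omega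
    rw [hμ]
    simp only [this, if_false, smul_smul]
  have hXμ : partialSum t μ a b n - X = c • F - (X - T) := by rw [← hFμ]; abel
  rw [hTμ, ← hX, hFμ, hXμ, norm_sub_sq_real (c • F), real_inner_smul_left] at key
  rw [hdiff, norm_sub_sq_real F]
  -- Optimality of `T` for the inflated sum says `2c⟪F, X - T⟫ ≤ ‖X - T‖²`; multiplying by `σ (m +
  -- 1)` turns `c` into `σ m`.
  have h1 : σ (m + 1) * (2 * (c * inner ℝ F (X - T))) ≤ σ (m + 1) * ‖X - T‖ ^ 2 :=
    mul_le_mul_of_nonneg_left (by linarith) hpos.le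
  have h2 : σ (m + 1) * (2 * (c * inner ℝ F (X - T))) = 2 * (σ m * inner ℝ F (X - T)) := by
    rw [← hc1]; ring
  linarith

end LowRank

/-! ### Truncations of separable component decompositions -/

open Filter Topology

section Perturbation

variable {H₁ H₂ : Type*} [NormedAddCommGroup H₁] [InnerProductSpace ℝ H₁] [CompleteSpace H₁]
  [NormedAddCommGroup H₂] [InnerProductSpace ℝ H₂] [CompleteSpace H₂]
  {C : HS (HTensor H₁ H₂)} {σ : ℕ → ℝ} {A : ℕ → HS H₁} {B : ℕ → HS H₂}

theorem IsSCD.tendsto (h : IsSCD C σ A B) : Tendsto (bestSeparable σ A B) atTop (𝓝 C) :=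
  h.hasSum.tendsto_sum_nat

theorem IsSCD.norm_sq_bestSeparable (h : IsSCD C σ A B) (n : ℕ) :
    ‖bestSeparable σ A B n‖ ^ 2 = ∑ r ∈ Finset.range n, σ r ^ 2 :=
  norm_sq_sum_tensor_of_orthonormal (t := HS.tensorₗ) HS.inner_tensor h.orthonormal_left
    h.orthonormal_right _

theorem IsSCD.norm_bestSeparable_le (h : IsSCD C σ A B) (n : ℕ) :
    ‖bestSeparable σ A B n‖ ≤ ‖C‖ := by
  refine ge_of_tendsto h.tendsto.norm ((eventually_ge_atTop n).mono fun k hk => ?_)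
  refine le_of_sq_le_sq ?_ (norm_nonneg _)
  rw [h.norm_sq_bestSeparable, h.norm_sq_bestSeparable]
  exact Finset.sum_le_sum_of_subset_of_nonneg (Finset.range_mono hk) fun r _ _ => sq_nonneg _

theorem IsSCD.score_le_norm (h : IsSCD C σ A B) (r : ℕ) : σ r ≤ ‖C‖ := by
  refine le_trans (le_of_sq_le_sq ?_ (norm_nonneg _)) (h.norm_bestSeparable_le (r + 1))
  rw [h.norm_sq_bestSeparable]
  exact Finset.single_le_sum (f := fun r => σ r ^ 2) (fun r _ => sq_nonneg _)
    (Finset.self_mem_range_succ r)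

theorem IsSCD.bestSeparable_eq_of_score_eq_zero (h : IsSCD C σ A B) {m R : ℕ} (hm : σ m = 0)
    (hR : m ≤ R) : bestSeparable σ A B R = C := by
  have h0 : ∀ r, r ∉ Finset.range R → σ r • HS.tensor (A r) (B r) = 0 := by
    intro r hr
    have : σ r = 0 := le_antisymm
      (hm ▸ h.antitone (hR.trans (not_lt.1 fun hlt => hr (Finset.mem_range.2 hlt)))) (h.nonneg r)
    rw [this, zero_smul]
  exact (hasSum_sum_of_ne_finset_zero h0).unique h.hasSum

/-- A truncation is a sum of at most `R` tensors with orthonormal left factors. -/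
theorem IsSCD.exists_orthonormal_representation (h : IsSCD C σ A B) (R : ℕ) :
    ∃ (J : Finset ℕ) (Y : J → HS H₂), Orthonormal ℝ (fun j : J => A j) ∧ Fintype.card J ≤ R ∧
      bestSeparable σ A B R = ∑ j : J, HS.tensorₗ (A j) (Y j) := by
  -- Indices of score zero are dropped, since orthonormality is known only off them; the scores go
  -- into the right factors.
  refine ⟨(Finset.range R).filter fun r => σ r ≠ 0, fun j => σ j • B j, ?_, ?_, ?_⟩
  · exact h.orthonormal_left.comp
      (fun j : (Finset.range R).filter fun r => σ r ≠ 0 =>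
        (⟨j.1, (Finset.mem_filter.1 j.2).2⟩ : {r : ℕ // σ r ≠ 0}))
      fun i j hij => Subtype.ext (congrArg (fun z : {r : ℕ // σ r ≠ 0} => z.1) hij)
  · rw [Fintype.card_coe]
    exact (Finset.card_filter_le _ _).trans (Finset.card_range R).le
  · rw [Finset.sum_coe_sort ((Finset.range R).filter fun r => σ r ≠ 0)
      (fun j => HS.tensorₗ (A j) (σ j • B j)), Finset.sum_filter, bestSeparable]
    refine Finset.sum_congr rfl fun r _ => ?_
    by_cases hr : σ r = 0
    · simp [hr]
    · simp [hr]

/-- The truncation to the `R` leading components of an SCD is a best approximation among the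
truncations to `R` components of all SCDs. -/
theorem IsSCD.norm_sub_bestSeparable_le (h : IsSCD C σ A B) {C' : HS (HTensor H₁ H₂)}
    {σ' : ℕ → ℝ} {A' : ℕ → HS H₁} {B' : ℕ → HS H₂} (h' : IsSCD C' σ' A' B') (R : ℕ) :
    ‖C - bestSeparable σ A B R‖ ≤ ‖C - bestSeparable σ' A' B' R‖ := by
  obtain ⟨J, Y, hJ, hcard, hX⟩ := h'.exists_orthonormal_representation R
  have key : ∀ n ≥ R, ‖bestSeparable σ A B n - bestSeparable σ A B R‖
      ≤ ‖bestSeparable σ A B n - bestSeparable σ' A' B' R‖ := by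
    intro n hn
    refine le_of_sq_le_sq ?_ (norm_nonneg _)
    rw [hX]
    exact eckart_young (t := HS.tensorₗ) HS.inner_tensor h.nonneg h.antitone h.orthonormal_left
      h.orthonormal_right hJ Y hcard hn
  exact le_of_tendsto_of_tendsto (h.tendsto.sub_const (bestSeparable σ A B R)).norm
    (h.tendsto.sub_const (bestSeparable σ' A' B' R)).norm ((eventually_ge_atTop R).mono key)

/-- The limit `n → ∞` of the estimate for finite sums, whose constants do not depend on `n`. -/
theorem IsSCD.quadratic_growth (h : IsSCD C σ A B) {C' : HS (HTensor H₁ H₂)}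
    {σ' : ℕ → ℝ} {A' : ℕ → HS H₁} {B' : ℕ → HS H₂} (h' : IsSCD C' σ' A' B') (m : ℕ) :
    (σ m - σ (m + 1)) * ‖bestSeparable σ' A' B' (m + 1) - bestSeparable σ A B (m + 1)‖ ^ 2
      ≤ σ m * (‖C - bestSeparable σ' A' B' (m + 1)‖ ^ 2
        - ‖C - bestSeparable σ A B (m + 1)‖ ^ 2) := by
  obtain ⟨J, Y, hJ, hcard, hX⟩ := h'.exists_orthonormal_representation (m + 1)
  refine ge_of_tendsto ((((h.tendsto.sub_const _).norm.pow 2).sub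
    ((h.tendsto.sub_const _).norm.pow 2)).const_mul (σ m))
    ((eventually_ge_atTop (m + 1)).mono fun n hn => ?_)
  rw [hX]
  exact truncation_quadratic_growth HS.inner_tensor h.nonneg h.antitone h.orthonormal_left
    h.orthonormal_right hJ Y hcard hn

/-- Perturbation bound for the truncation in terms of the gap below its last score. -/
theorem IsSCD.gap_mul_norm_sub_le (h : IsSCD C σ A B) {C' : HS (HTensor H₁ H₂)}
    {σ' : ℕ → ℝ} {A' : ℕ → HS H₁} {B' : ℕ → HS H₂} (h' : IsSCD C' σ' A' B') (m : ℕ) :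
    (σ m - σ (m + 1)) * ‖bestSeparable σ A B (m + 1) - bestSeparable σ' A' B' (m + 1)‖
      ≤ 2 * σ m * ‖C - C'‖ := by
  set T := bestSeparable σ A B (m + 1)
  set X := bestSeparable σ' A' B' (m + 1)
  have h1 : (σ m - σ (m + 1)) * ‖X - T‖ ^ 2 ≤ σ m * (‖C - X‖ ^ 2 - ‖C - T‖ ^ 2) :=
    h.quadratic_growth h' m
  have h2 : ‖C' - X‖ ^ 2 ≤ ‖C' - T‖ ^ 2 :=
    pow_le_pow_left₀ (norm_nonneg _) (h'.norm_sub_bestSeparable_le h (m + 1)) 2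
  -- The difference of squared distances to `X` and `T` is affine in the centre, so moving the
  -- centre from `C'` to `C` adds only an inner product.
  have h3 : ‖C - X‖ ^ 2 - ‖C - T‖ ^ 2
      = ‖C' - X‖ ^ 2 - ‖C' - T‖ ^ 2 + 2 * inner ℝ (C - C') (T - X) := by
    simp only [norm_sub_sq_real, inner_sub_left, inner_sub_right]
    ring
  have h4 : inner ℝ (C - C') (T - X) ≤ ‖C - C'‖ * ‖T - X‖ := real_inner_le_norm _ _
  rw [norm_sub_rev X T] at h1
  have h5 : σ m * (‖C - X‖ ^ 2 - ‖C - T‖ ^ 2) ≤ σ m * (2 * (‖C - C'‖ * ‖T - X‖)) :=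
    mul_le_mul_of_nonneg_left (by linarith) (h.nonneg m)
  rcases (norm_nonneg (T - X)).eq_or_lt with h0 | hpos
  · rw [← h0, mul_zero]
    exact mul_nonneg (mul_nonneg zero_le_two (h.nonneg m)) (norm_nonneg _)
  · refine le_of_mul_le_mul_right ?_ hpos
    linarith

/-! ### Score gaps and the size of the coefficient -/

theorem IsSCD.scoreGap_pos (h : IsSCD C σ A B) {R : ℕ}
    (hgap : ∀ r < R, σ r ≠ 0 → σ (r + 1) < σ r) {r : ℕ} (hr : r < R) (h0 : σ r ≠ 0) :
    0 < scoreGap σ r := by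
  have key : ∀ q < R, σ q ≠ 0 → 0 < σ q ^ 2 - σ (q + 1) ^ 2 := fun q hq hq0 =>
    sub_pos.2 (pow_lt_pow_left₀ (hgap q hq hq0) (h.nonneg _) two_ne_zero)
  cases r with
  | zero => exact key 0 hr h0
  | succ q =>
    refine lt_min (key q (q.lt_succ_self.trans hr) ?_) (key (q + 1) hr h0)
    exact (((h.nonneg (q + 1)).lt_of_ne' h0).trans_le (h.antitone q.le_succ)).ne'

theorem scoreGap_le (σ : ℕ → ℝ) (r : ℕ) : scoreGap σ r ≤ σ r ^ 2 - σ (r + 1) ^ 2 := by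
  cases r with
  | zero => exact le_rfl
  | succ q => exact min_le_right _ _

theorem IsSCD.div_scoreGap_nonneg (h : IsSCD C σ A B) {R : ℕ}
    (hgap : ∀ r < R, σ r ≠ 0 → σ (r + 1) < σ r) {r : ℕ} (hr : r < R) :
    0 ≤ σ r / scoreGap σ r := by
  by_cases h0 : σ r = 0
  · rw [h0, zero_div]
  · exact div_nonneg (h.nonneg r) (h.scoreGap_pos hgap hr h0).le

/-- A single nonzero score already bounds the coefficient of the perturbation bound from below. -/
theorem IsSCD.two_mul_score_le (h : IsSCD C σ A B) {R : ℕ}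
    (hgap : ∀ r < R, σ r ≠ 0 → σ (r + 1) < σ r) {r : ℕ} (hr : r < R) (h0 : σ r ≠ 0)
    (C' : HS (HTensor H₁ H₂)) :
    2 * σ r ≤ (σ r - σ (r + 1)) * (4 * Real.sqrt 2 * (‖C‖ + ‖C'‖)
      * (∑ q ∈ Finset.range R, σ q / scoreGap σ q)) := by
  have hα := h.scoreGap_pos hgap hr h0
  have hs : 0 < σ r := (h.nonneg r).lt_of_ne' h0
  have hg : 0 < σ r - σ (r + 1) := sub_pos.2 (hgap r hr h0)
  have h1 : σ r / scoreGap σ r ≤ ∑ q ∈ Finset.range R, σ q / scoreGap σ q :=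
    Finset.single_le_sum (f := fun q => σ q / scoreGap σ q)
      (fun q hq => h.div_scoreGap_nonneg hgap (Finset.mem_range.1 hq)) (Finset.mem_range.2 hr)
  -- Only the lower half of the gap matters: `scoreGap σ r ≤ (σ r - σ (r + 1)) (σ r + σ (r + 1))`,
  -- and the second factor is at most `2 σ r`.
  have h2 : 1 ≤ 2 * (σ r - σ (r + 1)) * (σ r / scoreGap σ r) := by
    rw [← mul_div_assoc, le_div_iff₀ hα, one_mul]
    nlinarith [scoreGap_le σ r, sq_nonneg (σ r - σ (r + 1))]
  have h3 : 1 ≤ 2 * (σ r - σ (r + 1)) * ∑ q ∈ Finset.range R, σ q / scoreGap σ q :=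
    h2.trans (mul_le_mul_of_nonneg_left h1 (by positivity))
  have h4 : σ r ≤ ‖C‖ + ‖C'‖ := (h.score_le_norm r).trans (le_add_of_nonneg_right (norm_nonneg _))
  have h5 : (1 : ℝ) ≤ Real.sqrt 2 := Real.one_le_sqrt.2 one_le_two
  have h6 : 1 * σ r ≤ Real.sqrt 2 * (‖C‖ + ‖C'‖) :=
    mul_le_mul h5 h4 hs.le (Real.sqrt_nonneg 2)
  have h7 := mul_le_mul h6 h3 zero_le_one (by positivity)
  linarith

end Perturbation

end PSCA

/-! ### The perturbation bound -/

theorem mainTheorem4 {H₁ H₂ : Type*}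
    [NormedAddCommGroup H₁] [InnerProductSpace ℝ H₁] [CompleteSpace H₁]
    [NormedAddCommGroup H₂] [InnerProductSpace ℝ H₂] [CompleteSpace H₂]
    (C C' : PSCA.HS (PSCA.HTensor H₁ H₂))
    (σ σ' : ℕ → ℝ) (A A' : ℕ → PSCA.HS H₁) (B B' : ℕ → PSCA.HS H₂)
    (hC : PSCA.IsSCD C σ A B) (hC' : PSCA.IsSCD C' σ' A' B')
    (R : ℕ) (hgap : ∀ r < R, σ r ≠ 0 → σ (r + 1) < σ r) :
    ‖PSCA.bestSeparable σ A B R - PSCA.bestSeparable σ' A' B' R‖ ≤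
      (4 * Real.sqrt 2 * (‖C‖ + ‖C'‖) * (∑ r ∈ Finset.range R, σ r / PSCA.scoreGap σ r) + 1)
        * ‖C - C'‖ := by
  set K := 4 * Real.sqrt 2 * (‖C‖ + ‖C'‖) * (∑ r ∈ Finset.range R, σ r / PSCA.scoreGap σ r)
    with hK
  have hD := norm_nonneg (C - C')
  have hK0 : 0 ≤ K := by
    have : 0 ≤ ∑ r ∈ Finset.range R, σ r / PSCA.scoreGap σ r :=
      Finset.sum_nonneg fun r hr => hC.div_scoreGap_nonneg hgap (Finset.mem_range.1 hr)
    positivity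
  rcases R with _ | m
  · simp only [PSCA.bestSeparable, Finset.range_zero, Finset.sum_empty, sub_self, norm_zero]
    positivity
  by_cases hm : σ m = 0
  · have hT : PSCA.bestSeparable σ A B (m + 1) = C :=
      hC.bestSeparable_eq_of_score_eq_zero hm m.le_succ
    -- For `C = 0` the coefficient may be just `1`, and truncation not increasing the norm is
    -- enough.
    by_cases h0 : σ 0 = 0
    · have hC0 : C = 0 := by
        rw [← hC.bestSeparable_eq_of_score_eq_zero h0 le_rfl, PSCA.bestSeparable,
          Finset.range_zero, Finset.sum_empty]
      rw [hT, hC0, zero_sub, norm_neg, zero_sub, norm_neg]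
      have := hC'.norm_bestSeparable_le (m + 1)
      nlinarith [mul_nonneg hK0 (norm_nonneg C')]
    -- `C` is its own truncation, hence a competitor for `C'`. The triangle inequality then gives
    -- the constant `2`, which the leading score shows to be at most `K`.
    · have h1 : ‖C' - PSCA.bestSeparable σ' A' B' (m + 1)‖ ≤ ‖C - C'‖ := by
        rw [norm_sub_rev C C']
        conv_rhs => rw [← hT]
        exact hC'.norm_sub_bestSeparable_le hC (m + 1)
      have h2 := norm_sub_le_norm_sub_add_norm_sub C C' (PSCA.bestSeparable σ' A' B' (m + 1))
      have h3 := hC.two_mul_score_le hgap m.succ_pos h0 C'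
      rw [← hK] at h3
      have hs : 0 < σ 0 := (hC.nonneg 0).lt_of_ne' h0
      have h4 : 2 ≤ K := by
        refine le_of_mul_le_mul_left ?_ hs
        nlinarith [mul_nonneg (hC.nonneg (0 + 1)) hK0]
      rw [hT]
      nlinarith
  · have hg : 0 < σ m - σ (m + 1) := sub_pos.2 (hgap m m.lt_succ_self hm)
    have h1 := hC.gap_mul_norm_sub_le hC' m
    have h2 := hC.two_mul_score_le hgap m.lt_succ_self hm C'
    rw [← hK] at h2
    refine le_of_mul_le_mul_left ?_ hg
    nlinarith [mul_le_mul_of_nonneg_right h2 hD, mul_nonneg hg.le hD]
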